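/- Let $d,n\ge 1$, $\mathbf F\in\{\mathbf R,\mathbf C\}$, $u\cdot v=\sum_k u_k\overline{v_k}$ on $\mathbf F^n$. Let $\mathcal K$ be the collection of non-empty closed sets $K\subseteq\mathbf F^n$ that are convex and satisfy $\lambda K\subseteq K$ for all $\lambda\in\mathbf F$ with $|\lambda|=1$; for $K,L\in\mathcal K$, $\lambda\in\mathbf F$ put $K+L:=\overline{\{u+v:u\in K,\,v\in L\}}$ and $\lambda K:=\{\lambda u:u\in K\}$, and for $u\in\mathbf F^n$ put $\mathcal K(u):=\{\lambda u:\lambda\in\mathbf F,\ |\lambda|\le1\}$. Let $L^0(\mathbf R^d;\mathbf F^n)$ be the space of measurable functions modulo a.e. equality, and let $L^0(\mathbf R^d;\mathcal K)$ be the space, modulo a.e. equality, of mappings $F:\mathbf R^d\to\mathcal K$ such that $\{x:F(x)\cap E\ne\emptyset\}$ is Lebesgue measurable for every Borel set $E\subseteq\mathbf F^n$; sums and scalar multiples of such mappings are taken pointwise. Let $\mathbf X$ be an $\mathbf F^n$-directional Banach function space over $\mathbf R^d$: a linear subspace of $L^0(\mathbf R^d;\mathbf F^n)$ with a complete norm such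 that (i) if $f\in\mathbf X$, $g\in L^0(\mathbf R^d;\mathbf F^n)$ and $\mathcal K(g(x))\subseteq\mathcal K(f(x))$ a.e., then $g\in\mathbf X$ and $\|g\|_{\mathbf X}\le\|f\|_{\mathbf X}$; (ii) if $g\in L^0(\mathbf R^d;\mathbf F^n)$ is such that $f\cdot g$ is integrable with $\int_{\mathbf R^d} f\cdot g\,\mathrm dx=0$ for all $f\in\mathbf X$, then $g=0$. Assume that $\mathbf X$ has the Fatou property: if $f_k\in\mathbf X$, $f\in L^0(\mathbf R^d;\mathbf F^n)$, $f_k\to f$ a.e. and $\liminf_k\|f_k\|_{\mathbf X}<\infty$, then $f\in\mathbf X$ and $\|f\|_{\mathbf X}\le\liminf_k\|f_k\|_{\mathbf X}$. Let $\mathbf X[\mathcal K]$ be the set of $F\in L^0(\mathbf R^d;\mathcal K)$ whose set of measurable selections $S^0(F)=\{f\in L^0(\mathbf R^d;\mathbf F^n): f(x)\in F(x)\text{ a.e.}\}$ is a bounded subset of $\mathbf X$, with $\|F\|_{\mathbf X[\mathcal K]}:=\sup_{f\in S^0(F)}\|f\|_{\mathbf X}$. A map $T:\mathbf X[\mathcal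 K]\to\mathbf X[\mathcal K]$ is bounded if there is $C\ge0$ with $\|TF\|_{\mathbf X[\mathcal K]}\le C\|F\|_{\mathbf X[\mathcal K]}$ for all $F\in\mathbf X[\mathcal K]$; the smallest such $C$ is denoted by $\|T\|$. **Theorem (Rubio de Francia algorithm).** Let $\mathbf X$ be as above, and let $T:\mathbf X[\mathcal K]\to\mathbf X[\mathcal K]$ be a bounded map that is sublinear (but not necessarily monotone): for all $F,G\in\mathbf X[\mathcal K]$ and $\lambda\in\mathbf F$, $$T(F+G)(x)\subseteq TF(x)+TG(x),\qquad T(\lambda F)(x)=\lambda\,TF(x)\qquad\text{for a.e. }x.$$ Then there is a map $\mathcal R:\mathbf X[\mathcal K]\to\mathbf X[\mathcal K]$, bounded with $\|\mathcal R\|\le2$, such that for all $F\in\mathbf X[\mathcal K]$: (a) $F(x)\subseteq\mathcal RF(x)$ for a.e. $x$; (b) $T(\mathcal RF)(x)\subseteq2\|T\|\,\mathcal RF(x)$ for a.e. $x$. -/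

import Mathlib

open MeasureTheory Filter Topology
open scoped Pointwise ENNReal

noncomputable section

/-- The collection `𝒦` of nonempty closed subsets of `𝕜ⁿ` that are convex and symmetric
(stable under multiplication by scalars of modulus one). They need not be bounded. -/
structure ConvexSymmSet (𝕜 : Type*) [RCLike 𝕜] (n : ℕ) where
  carrier : Set (EuclideanSpace 𝕜 (Fin n))
  nonempty' : carrier.Nonempty
  isClosed' : IsClosed carrier
  convex' : Convex ℝ carrier
  symm' : ∀ u ∈ carrier, ∀ c : 𝕜, ‖c‖ = 1 → c • u ∈ carrier

/-- A member of `𝒦` is read as a set. -/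
instance ConvexSymmSet.instCoeSet {𝕜 : Type*} [RCLike 𝕜] {n : ℕ} :
    CoeOut (ConvexSymmSet 𝕜 n) (Set (EuclideanSpace 𝕜 (Fin n))) :=
  ⟨ConvexSymmSet.carrier⟩

/-- `𝒦(u) = {c u : c ∈ 𝕜, |c| ≤ 1}`, the smallest member of `𝒦` that contains `u`. -/
def dirBody {𝕜 : Type*} [RCLike 𝕜] {n : ℕ} (u : EuclideanSpace 𝕜 (Fin n)) :
    Set (EuclideanSpace 𝕜 (Fin n)) :=
  {v | ∃ c : 𝕜, ‖c‖ ≤ 1 ∧ v = c • u}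

/-- Measurability of a set-valued mapping: for every measurable (Borel) `E ⊆ 𝕜ⁿ` the set of `x`
for which `F x` meets `E` is measurable. Measurability in `Ω` refers to the completion of `μ`
(for Lebesgue measure: the Lebesgue measurable sets), which is what `NullMeasurableSet` says. -/
def SetValuedMeasurable {𝕜 : Type*} [RCLike 𝕜] {n : ℕ} {Ω : Type*} [MeasurableSpace Ω]
    (μ : Measure Ω) (F : Ω → ConvexSymmSet 𝕜 n) : Prop :=
  ∀ E : Set (EuclideanSpace 𝕜 (Fin n)), MeasurableSet E →
    NullMeasurableSet {x | ((F x : Set (EuclideanSpace 𝕜 (Fin n))) ∩ E).Nonempty} μ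

/-- Almost everywhere equality of measurable mappings into `𝒦`. -/
def convexMapSetoid (𝕜 : Type*) [RCLike 𝕜] (n : ℕ) {Ω : Type*} [MeasurableSpace Ω]
    (μ : Measure Ω) :
    Setoid {F : Ω → ConvexSymmSet 𝕜 n // SetValuedMeasurable μ F} where
  r F G := F.1 =ᵐ[μ] G.1
  iseqv := ⟨fun _ => EventuallyEq.rfl, fun h => h.symm, fun h₁ h₂ => h₁.trans h₂⟩

/-- The space `L⁰(Ω; 𝒦)` of measurable mappings `Ω → 𝒦` modulo almost everywhere equality. -/
def L0K (𝕜 : Type*) [RCLike 𝕜] (n : ℕ) {Ω : Type*} [MeasurableSpace Ω] (μ : Measure Ω) : Type _ :=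
  Quotient (convexMapSetoid 𝕜 n μ)

namespace L0K

variable {𝕜 : Type*} [RCLike 𝕜] {n : ℕ} {Ω : Type*} [MeasurableSpace Ω] {μ : Measure Ω}

/-- The class of a measurable mapping. -/
def mk (F : Ω → ConvexSymmSet 𝕜 n) (hF : SetValuedMeasurable μ F) : L0K 𝕜 n μ :=
  Quotient.mk (convexMapSetoid 𝕜 n μ) ⟨F, hF⟩

/-- A representative of a class. -/
def rep (F : L0K 𝕜 n μ) : Ω → ConvexSymmSet 𝕜 n := (Quotient.out F).1

/-- The set `F(x)`, by means of a representative; it matters only almost everywhere. -/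
def val (F : L0K 𝕜 n μ) (x : Ω) : Set (EuclideanSpace 𝕜 (Fin n)) := (F.rep x).carrier

theorem measurable_rep (F : L0K 𝕜 n μ) : SetValuedMeasurable μ F.rep := (Quotient.out F).2

theorem rep_mk (F : Ω → ConvexSymmSet 𝕜 n) (hF : SetValuedMeasurable μ F) :
    (mk F hF).rep =ᵐ[μ] F :=
  Quotient.exact (s := convexMapSetoid 𝕜 n μ) (Quotient.out_eq (mk F hF))

theorem ext {F G : L0K 𝕜 n μ} (h : ∀ᵐ x ∂μ, F.val x = G.val x) : F = G := by
  have h' : F.rep =ᵐ[μ] G.rep := by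
    filter_upwards [h] with x hx
    cases hF : F.rep x
    cases hG : G.rep x
    simp only [val, hF, hG] at hx
    subst hx
    rfl
  rw [← Quotient.out_eq F, ← Quotient.out_eq G]
  exact Quotient.sound (s := convexMapSetoid 𝕜 n μ) h'

/-- The set `S⁰(Ω; F)` of measurable selections of `F`. -/
def selections (F : L0K 𝕜 n μ) : Set (Ω →ₘ[μ] EuclideanSpace 𝕜 (Fin n)) :=
  {f | ∀ᵐ x ∂μ, f x ∈ F.val x}

end L0K

/-- A `𝕜ⁿ`-directional Banach function space over `(Ω, μ)`: a linear subspace of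
`L⁰(Ω; 𝕜ⁿ)` with a complete norm (a seminorm that vanishes only at `0`), with the directional
ideal property and non-degeneracy. The scalar product `f · g = ∑ₖ fₖ conj(gₖ)` is `inner 𝕜 g f`. -/
structure DirectionalBFS (𝕜 : Type*) [RCLike 𝕜] (n : ℕ) {Ω : Type*} [MeasurableSpace Ω]
    (μ : Measure Ω) where
  carrier : Submodule 𝕜 (Ω →ₘ[μ] EuclideanSpace 𝕜 (Fin n))
  norm : Seminorm 𝕜 carrier
  eq_zero_of_norm : ∀ f : carrier, norm f = 0 → f = 0
  complete : ∀ f : ℕ → carrier,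
    (∀ ε : ℝ, 0 < ε → ∃ N, ∀ j ≥ N, ∀ k ≥ N, norm (f j - f k) < ε) →
      ∃ g : carrier, Tendsto (fun k => norm (f k - g)) atTop (𝓝 0)
  ideal : ∀ (f : carrier) (g : Ω →ₘ[μ] EuclideanSpace 𝕜 (Fin n)),
    (∀ᵐ x ∂μ, dirBody (𝕜 := 𝕜) (g x) ⊆
      dirBody ((f : Ω →ₘ[μ] EuclideanSpace 𝕜 (Fin n)) x)) →
      ∃ hg : g ∈ carrier, norm ⟨g, hg⟩ ≤ norm f
  nondegenerate : ∀ g : Ω →ₘ[μ] EuclideanSpace 𝕜 (Fin n),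
    (∀ f ∈ carrier, Integrable (fun x => inner 𝕜 (g x) (f x)) μ ∧
      ∫ x, inner 𝕜 (g x) (f x) ∂μ = 0) → g = 0

namespace DirectionalBFS

variable {𝕜 : Type*} [RCLike 𝕜] {n : ℕ} {Ω : Type*} [MeasurableSpace Ω] {μ : Measure Ω}

/-- The Fatou property; the limit inferior is taken in `[0, ∞]`. -/
def FatouProperty (X : DirectionalBFS 𝕜 n μ) : Prop :=
  ∀ (f : ℕ → X.carrier) (g : Ω →ₘ[μ] EuclideanSpace 𝕜 (Fin n)),
    (∀ᵐ x ∂μ, Tendsto (fun k => (f k : Ω →ₘ[μ] EuclideanSpace 𝕜 (Fin n)) x) atTop (𝓝 (g x))) →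
    liminf (fun k => ENNReal.ofReal (X.norm (f k))) atTop < ∞ →
      ∃ hg : g ∈ X.carrier,
        ENNReal.ofReal (X.norm ⟨g, hg⟩) ≤ liminf (fun k => ENNReal.ofReal (X.norm (f k))) atTop

/-- The space `X[𝒦]` of those `F ∈ L⁰(Ω; 𝒦)` whose selections form a bounded subset of `X`. -/
def ConvexSpace (X : DirectionalBFS 𝕜 n μ) : Type _ :=
  {F : L0K 𝕜 n μ // ∃ C : ℝ, ∀ f ∈ F.selections, ∃ hf : f ∈ X.carrier, X.norm ⟨f, hf⟩ ≤ C}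

/-- The underlying class of mappings `Ω → 𝒦`. -/
def ConvexSpace.toL0K {X : DirectionalBFS 𝕜 n μ} (F : X.ConvexSpace) : L0K 𝕜 n μ := F.1

/-- A member `F` of `X[𝒦]` is read as the set-valued mapping `x ↦ F(x)`. -/
instance (X : DirectionalBFS 𝕜 n μ) :
    CoeFun X.ConvexSpace (fun _ => Ω → Set (EuclideanSpace 𝕜 (Fin n))) :=
  ⟨fun F => F.toL0K.val⟩

/-- `‖F‖_{X[𝒦]}`, the supremum of `‖f‖_X` over the selections `f` of `F`. -/
def ConvexSpace.norm {X : DirectionalBFS 𝕜 n μ} (F : X.ConvexSpace) : ℝ :=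
  sSup {r : ℝ | ∃ f : X.carrier,
    (f : Ω →ₘ[μ] EuclideanSpace 𝕜 (Fin n)) ∈ F.toL0K.selections ∧ r = X.norm f}

/-- Boundedness of a map `T : X[𝒦] → X[𝒦]`. -/
def IsBoundedOp {X : DirectionalBFS 𝕜 n μ} (T : X.ConvexSpace → X.ConvexSpace) : Prop :=
  ∃ C : ℝ, 0 ≤ C ∧ ∀ F, (T F).norm ≤ C * F.norm

/-- `‖T‖_{X[𝒦] → X[𝒦]}`, the smallest `C ≥ 0` with `‖T F‖ ≤ C ‖F‖` for all `F` (for bounded `T`). -/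
def opNorm {X : DirectionalBFS 𝕜 n μ} (T : X.ConvexSpace → X.ConvexSpace) : ℝ :=
  sInf {C : ℝ | 0 ≤ C ∧ ∀ F, (T F).norm ≤ C * F.norm}

/-- Sublinearity of `T : X[𝒦] → X[𝒦]`: almost everywhere `T(F + G)(x) ⊆ TF(x) + TG(x)` and
`T(c F)(x) = c TF(x)`, where `+` is the closed Minkowski sum. Here `H` stands for the pointwise
sum `F + G`, respectively for the pointwise multiple `c F`, as a member of `X[𝒦]`. -/
def IsSublinear {X : DirectionalBFS 𝕜 n μ} (T : X.ConvexSpace → X.ConvexSpace) : Prop :=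
  (∀ F G H : X.ConvexSpace, (∀ᵐ x ∂μ, H x = closure (F x + G x)) →
    ∀ᵐ x ∂μ, T H x ⊆ closure (T F x + T G x)) ∧
  (∀ (c : 𝕜) (F H : X.ConvexSpace), (∀ᵐ x ∂μ, H x = c • F x) →
    ∀ᵐ x ∂μ, T H x = c • T F x)

end DirectionalBFS

end

/-! The map is the series RF = W₀, where U_k = (cT)^k F, c = 1/(2‖T‖) and W_j is the closed sum of
the U_k with k ≥ j. Since cT at least halves norms, ‖W_j‖ ≤ 2·2^(-j)‖F‖; this gives ‖R‖ ≤ 2, and (a)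
holds because F is the first summand. If ‖T‖ = 0, then TF = {0} a.e. and the identity serves as R.

For (b), T is only finitely subadditive and not monotone, so it cannot be applied to the series term
by term. But W_j = U_j + W_{j+1} and T(U_j) = c⁻¹U_{j+1}. Iterating subadditivity gives T(W₀) ⊆
c⁻¹W₁ + T(W_N) up to closure, for every N (`apply_iterateTail_subset`), where c⁻¹W₁ ⊆ 2‖T‖W₀. It
remains to discard T(W_N) almost everywhere (`ae_mem_of_forall_mem_closure_add`). Its norms are
summable, so the tail sums of the series of the T(W_N) decrease to a measurable map whose selections
all have norm 0, hence to {0} a.e. In finite dimension, closed convex symmetric sets that decrease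
to {0} eventually lie in every ball, by compactness of the sphere. The remainder thus becomes
arbitrarily small and the closed set 2‖T‖W₀(x) absorbs the limit.

The series itself needs no pointwise convergence: the closure of the union of the partial sums
always lies in 𝒦, even if unbounded. The Fatou property bounds its selections, which are a.e. limits
of selections of partial sums. Sums, series and intersections must also be measurable in the sense
of hitting all Borel sets; this rests on measurable projection and on measurable nearest points. -/

noncomputable section


/-! ### Analytic sets and measurable projection -/

/-- Continuity from below of an outer measure along the restriction of one coordinate. -/
theorem exists_lt_measure_image_inter_coord_le {X : Type*} [MeasurableSpace X] (μ : Measure X)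
    (f : (ℕ → ℕ) → X) (A : Set (ℕ → ℕ)) (k : ℕ) {r : ℝ≥0∞} (hr : r < μ (f '' A)) :
    ∃ m : ℕ, r < μ (f '' (A ∩ {a | a k ≤ m})) := by
  have hmono : Monotone fun m : ℕ => f '' (A ∩ {a | a k ≤ m}) := fun m m' hm =>
    Set.image_mono (Set.inter_subset_inter_right _ fun a (ha : a k ≤ m) => ha.trans hm)
  have hU : f '' A = ⋃ m : ℕ, f '' (A ∩ {a | a k ≤ m}) := by
    rw [← Set.image_iUnion, ← Set.inter_iUnion]
    congr 1
    refine (Set.inter_eq_left.2 fun a _ => ?_).symm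
    exact Set.mem_iUnion.2 ⟨a k, le_refl (a k)⟩
  rw [hU, hmono.directed_le.measure_iUnion] at hr
  exact lt_iSup_iff.1 hr

theorem isCompact_baire_box (N : ℕ → ℕ) : IsCompact {a : ℕ → ℕ | ∀ i, a i ≤ N i} := by
  convert isCompact_univ_pi (fun i : ℕ => (Set.finite_Iic (N i)).isCompact) using 1
  ext a
  simp [Pi.le_def]

/-- An open set containing the box `∏ [0, N k]` of the Baire space contains a cylinder over it. -/
theorem exists_cylinder_subset_of_box_subset (N : ℕ → ℕ) {V : Set (ℕ → ℕ)} (hV : IsOpen V)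
    (hN : {a : ℕ → ℕ | ∀ i, a i ≤ N i} ⊆ V) :
    ∃ k, {a : ℕ → ℕ | ∀ i < k, a i ≤ N i} ⊆ V := by
  by_contra! h
  simp only [Set.not_subset] at h
  choose a haN haV using h
  -- Truncating the `k`-th point at `N` puts it in the compact box and leaves its first `k`
  -- coordinates unchanged, so a limit of the truncated points is a limit of the points themselves.
  obtain ⟨b, hb, φ, hφ, hlim⟩ := (isCompact_baire_box N).tendsto_subseq
    (x := fun k i => min (a k i) (N i)) (fun k i => min_le_right _ _)
  have hlim' : Tendsto (a ∘ φ) atTop (𝓝 b) := by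
    rw [tendsto_pi_nhds] at hlim ⊢
    intro i
    refine (hlim i).congr' ?_
    filter_upwards [eventually_gt_atTop i] with j hj
    exact min_eq_left (haN (φ j) i (hj.trans_le (hφ.id_le j)))
  obtain ⟨j, hj⟩ := (hlim'.eventually (hV.mem_nhds (hN hb))).exists
  exact haV _ hj

/-- Analytic sets are approximated from inside in measure by compact sets. -/
theorem MeasureTheory.AnalyticSet.exists_isCompact_subset_le_measure {X : Type*} [TopologicalSpace X]
    [MeasurableSpace X] {μ : Measure X} [μ.OuterRegular] {s : Set X}
    (hs : AnalyticSet s) {r : ℝ≥0∞} (hr : r < μ s) : ∃ K ⊆ s, IsCompact K ∧ r ≤ μ K := by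
  rw [AnalyticSet] at hs
  rcases hs with rfl | ⟨f, hf, rfl⟩
  · simp at hr
  -- The hypothesis stands under the existential so that `choose` yields a bound for every set `A`,
  -- from which the sets can be defined by recursion.
  have hstep : ∀ (k : ℕ) (A : Set (ℕ → ℕ)), ∃ m : ℕ, r < μ (f '' A) →
      r < μ (f '' (A ∩ {a | a k ≤ m})) := by
    intro k A
    by_cases h : r < μ (f '' A)
    · obtain ⟨m, hm⟩ := exists_lt_measure_image_inter_coord_le μ f A k h
      exact ⟨m, fun _ => hm⟩
    · exact ⟨0, fun h' => absurd h' h⟩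
  choose m hm using hstep
  let A : ℕ → Set (ℕ → ℕ) := fun k =>
    Nat.rec Set.univ (fun k A => A ∩ {a | a k ≤ m k A}) k
  have hA : ∀ k, r < μ (f '' A k) := by
    intro k
    induction k with
    | zero => simpa [A] using hr
    | succ k ih => exact hm k _ ih
  set N : ℕ → ℕ := fun k => m k (A k) with hNdef
  have hAN : ∀ k, A k = {a | ∀ i < k, a i ≤ N i} := by
    intro k
    induction k with
    | zero => ext; simp [A]
    | succ k ih =>
      have : A (k + 1) = A k ∩ {a | a k ≤ N k} := rfl
      rw [this, ih]
      ext a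
      simp only [Set.mem_inter_iff, Set.mem_ofPred_eq, Nat.lt_succ_iff_lt_or_eq]
      constructor
      · rintro ⟨h1, h2⟩ i (hi | rfl)
        exacts [h1 i hi, h2]
      · exact fun h => ⟨fun i hi => h i (Or.inl hi), h k (Or.inr rfl)⟩
  refine ⟨f '' {a | ∀ i, a i ≤ N i}, Set.image_subset_range _ _, (isCompact_baire_box N).image hf, ?_⟩
  -- The measure is not continuous along the decreasing images. Outer regularity helps: an open set
  -- containing the image of the box contains the image of some cylinder `A k`, which has measure
  -- above `r`.
  rw [Set.measure_eq_iInf_isOpen]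
  refine le_iInf₂ fun U hU => le_iInf fun hUo => ?_
  obtain ⟨k, hk⟩ := exists_cylinder_subset_of_box_subset N (hUo.preimage hf)
    (Set.image_subset_iff.1 hU)
  rw [← hAN] at hk
  exact (hA k).le.trans (measure_mono (Set.image_subset_iff.2 hk))

/-- Analytic sets in a Polish space are universally measurable. -/
theorem MeasureTheory.AnalyticSet.nullMeasurableSet {X : Type*} [TopologicalSpace X] [PolishSpace X]
    [MeasurableSpace X] [BorelSpace X] (μ : Measure X) [SFinite μ] {s : Set X}
    (hs : AnalyticSet s) : NullMeasurableSet s μ := by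
  wlog hμ : IsFiniteMeasure μ generalizing μ
  · exact (this μ.toFinite inferInstance).mono_ac (absolutelyContinuous_toFinite μ)
  rcases eq_or_ne (μ s) 0 with h0 | h0
  · exact NullMeasurableSet.of_null h0
  obtain ⟨r, -, hr, hlim⟩ := exists_seq_strictMono_tendsto' (pos_iff_ne_zero.2 h0)
  choose K hKs hKc hrK using fun k =>
    AnalyticSet.exists_isCompact_subset_le_measure (μ := μ) hs (hr k).2
  have hle : μ s ≤ μ (⋃ k, K k) :=
    le_of_tendsto' hlim fun k => (hrK k).trans (measure_mono (Set.subset_iUnion K k))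
  have hmeas : MeasurableSet (⋃ k, K k) := .iUnion fun k => (hKc k).measurableSet
  have := ae_eq_of_subset_of_measure_ge (Set.iUnion_subset hKs) hle hmeas.nullMeasurableSet
    (measure_ne_top μ s)
  exact hmeas.nullMeasurableSet.congr this

/-- Measurable projection: a set given by an existential over a standard Borel space is
null measurable. -/
theorem nullMeasurableSet_exists {Ω Y E : Type*} [MeasurableSpace Ω] {μ : Measure Ω} [SFinite μ]
    [MeasurableSpace Y] [StandardBorelSpace Y] [MeasurableSpace E] [StandardBorelSpace E]
    {h : Ω → Y} (hh : AEMeasurable h μ) {B : Set (Y × E)} (hB : MeasurableSet B) :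
    NullMeasurableSet {x | ∃ u, (h x, u) ∈ B} μ := by
  let _ := upgradeStandardBorel Y
  have hA : AnalyticSet (Prod.fst '' B) := hB.analyticSet_image measurable_fst
  -- The pushforward measure is the right one here: its null measurable sets pull back to null
  -- measurable sets for `μ`.
  have hn : NullMeasurableSet (Prod.fst '' B) (μ.map (hh.mk h)) :=
    AnalyticSet.nullMeasurableSet _ hA
  refine (hn.preimage (hh.measurable_mk.quasiMeasurePreserving μ)).congr ?_
  filter_upwards [hh.ae_eq_mk] with x hx
  refine propext ?_
  change hh.mk h x ∈ Prod.fst '' B ↔ ∃ u, (h x, u) ∈ B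
  rw [hx]
  simp


/-! ### Closed-valued maps described by distance functions -/

section MetricTarget

variable {Ω E : Type*} [MeasurableSpace Ω] {μ : Measure Ω} [MetricSpace E]

/-- A nonempty closed set is cut out by its distances to a dense sequence of points. -/
theorem IsClosed.mem_iff_forall_infDist_le_dist {F : Set E} (hF : IsClosed F) (hne : F.Nonempty)
    {q : ℕ → E} (hq : DenseRange q) (u : E) :
    u ∈ F ↔ ∀ i, Metric.infDist (q i) F ≤ dist (q i) u := by
  refine ⟨fun hu i => Metric.infDist_le_dist_of_mem hu, fun h => ?_⟩
  have hall : ∀ v, Metric.infDist v F ≤ dist v u := by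
    intro v
    have hcl : IsClosed {v | Metric.infDist v F ≤ dist v u} :=
      _root_.isClosed_le (Metric.continuous_infDist_pt F) (continuous_id.dist continuous_const)
    exact hq.induction_on (p := fun v => Metric.infDist v F ≤ dist v u) v hcl h
  have h0 := hall u
  rw [dist_self] at h0
  exact (hF.mem_iff_infDist_zero hne).2 (le_antisymm h0 Metric.infDist_nonneg)

/-- The distance to a set is the infimal convolution of its values on a dense sequence. -/
theorem Metric.infDist_eq_iInf_add_dist {q : ℕ → E} (hq : DenseRange q) (v : E) (F : Set E) :
    Metric.infDist v F = ⨅ i, (Metric.infDist (q i) F + dist v (q i)) := by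
  have : Nonempty E := ⟨v⟩
  refine le_antisymm (le_ciInf fun i => Metric.infDist_le_infDist_add_dist) ?_
  refine le_of_forall_pos_le_add fun ε hε => ?_
  obtain ⟨i, hi⟩ := hq.exists_dist_lt v (half_pos hε)
  refine (ciInf_le ⟨0, ?_⟩ i).trans ?_
  · rintro _ ⟨i, rfl⟩
    exact add_nonneg Metric.infDist_nonneg dist_nonneg
  · have := Metric.infDist_le_infDist_add_dist (s := F) (x := q i) (y := v)
    rw [dist_comm] at this
    linarith

/-- The infimal convolution formula reduces the distance at a moving point to countably many
distances at fixed points. -/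
theorem aemeasurable_infDist_comp [SecondCountableTopology E] [MeasurableSpace E] [BorelSpace E]
    {F : Ω → Set E} (hF : ∀ q, AEMeasurable (fun x => Metric.infDist q (F x)) μ) {f : Ω → E}
    (hf : AEMeasurable f μ) : AEMeasurable (fun x => Metric.infDist (f x) (F x)) μ := by
  rcases isEmpty_or_nonempty E with h | h
  · have : IsEmpty Ω := Function.isEmpty f
    exact (measurable_of_empty _).aemeasurable
  refine AEMeasurable.congr ?_ (.of_forall fun x =>
    (Metric.infDist_eq_iInf_add_dist (TopologicalSpace.denseRange_denseSeq E) (f x) (F x)).symm)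
  exact AEMeasurable.iInf fun i => (hF _).add (hf.dist aemeasurable_const)

/-- The distance from `q` is below `r` exactly when the set meets the open ball of radius `r` about
`q`. -/
theorem aemeasurable_infDist_of_hitting [MeasurableSpace E] [OpensMeasurableSpace E]
    {F : Ω → Set E} (hne : ∀ x, (F x).Nonempty)
    (hF : ∀ B, MeasurableSet B → NullMeasurableSet {x | (F x ∩ B).Nonempty} μ) (q : E) :
    AEMeasurable (fun x => Metric.infDist q (F x)) μ := by
  refine NullMeasurable.aemeasurable
    (@measurable_of_Iio ℝ (NullMeasurableSpace Ω μ) _ _ _ _ _ _ _ _ fun r => ?_)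
  have : (fun x => Metric.infDist q (F x)) ⁻¹' Set.Iio r =
      {x | (F x ∩ Metric.ball q r).Nonempty} := by
    ext x
    change Metric.infDist q (F x) < r ↔ _
    rw [Metric.infDist_lt_iff (hne x)]
    simp only [dist_comm q]
    rfl
  change NullMeasurableSet ((fun x => Metric.infDist q (F x)) ⁻¹' Set.Iio r : Set Ω) μ
  exact this ▸ hF (Metric.ball q r) Metric.isOpen_ball.measurableSet

/-- A pointwise choice of an index from a countable family is measurable. -/
theorem aemeasurable_comp_index {ι : Type*} [Countable ι] [MeasurableSpace E] [BorelSpace E]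
    [SecondCountableTopology E] {g : ι → Ω → E}
    (hg : ∀ i, AEMeasurable (g i) μ) {k : Ω → ι} (hk : ∀ i, NullMeasurableSet {x | k x = i} μ) :
    AEMeasurable (fun x => g (k x) x) μ := by
  refine NullMeasurable.aemeasurable fun B hB => ?_
  have : (fun x => g (k x) x) ⁻¹' B = ⋃ i, ({x | k x = i} ∩ g i ⁻¹' B) := by
    ext x
    simp
  rw [this]
  exact .iUnion fun i => (hk i).inter ((hg i).nullMeasurable hB)

variable [CompleteSpace E] [SecondCountableTopology E] [MeasurableSpace E] [BorelSpace E]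
  [SFinite μ]

/-- A map whose values are cut out by countably many measurable distance inequalities meets every
Borel set in a null measurable set of parameters. -/
theorem nullMeasurableSet_hitting_of_forall_le_dist {ι : Type*} [Countable ι] {φ : ι → Ω → ℝ}
    (hφ : ∀ i, AEMeasurable (φ i) μ) (q : ι → E) {B : Set E} (hB : MeasurableSet B) :
    NullMeasurableSet {x | ({u | ∀ i, φ i x ≤ dist (q i) u} ∩ B).Nonempty} μ := by
  have hh : AEMeasurable (fun x i => φ i x) μ := aemeasurable_pi_lambda _ hφ
  have hBm : MeasurableSet {z : (ι → ℝ) × E | (∀ i, z.1 i ≤ dist (q i) z.2) ∧ z.2 ∈ B} := by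
    refine MeasurableSet.inter ?_ (measurable_snd hB)
    have : {z : (ι → ℝ) × E | ∀ i, z.1 i ≤ dist (q i) z.2} =
        ⋂ i, {z : (ι → ℝ) × E | z.1 i ≤ dist (q i) z.2} := by ext; simp
    change MeasurableSet {z : (ι → ℝ) × E | ∀ i, z.1 i ≤ dist (q i) z.2}
    rw [this]
    exact .iInter fun i => measurableSet_le (by fun_prop) (by fun_prop)
  exact nullMeasurableSet_exists hh hBm

/-- The nearest point map of a measurable closed-valued map is measurable, if nearest points are
unique. -/
theorem aemeasurable_nearestPoint {F : Ω → Set E} (hne : ∀ x, (F x).Nonempty)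
    (hcl : ∀ x, IsClosed (F x)) (hF : ∀ q, AEMeasurable (fun x => Metric.infDist q (F x)) μ)
    {f p : Ω → E} (hf : AEMeasurable f μ)
    (hp : ∀ x u, u = p x ↔ u ∈ F x ∧ dist (f x) u ≤ Metric.infDist (f x) (F x)) :
    AEMeasurable p μ := by
  rcases isEmpty_or_nonempty E with h | h
  · have : IsEmpty Ω := Function.isEmpty f
    exact (measurable_of_empty _).aemeasurable
  set q := TopologicalSpace.denseSeq E
  have hq : DenseRange q := TopologicalSpace.denseRange_denseSeq E
  refine NullMeasurable.aemeasurable fun B hB => ?_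
  -- The dense distances determine `F x`, so being the nearest point is a Borel relation between the
  -- triple below and the point; measurable projection applies to it.
  have hh : AEMeasurable (fun x => ((fun i => Metric.infDist (q i) (F x)), f x,
      Metric.infDist (f x) (F x))) μ :=
    (aemeasurable_pi_lambda _ fun i => hF (q i)).prodMk
      (hf.prodMk (aemeasurable_infDist_comp hF hf))
  have hBm : MeasurableSet {z : ((ℕ → ℝ) × E × ℝ) × E |
      ((∀ i, z.1.1 i ≤ dist (q i) z.2) ∧ dist z.1.2.1 z.2 ≤ z.1.2.2) ∧ z.2 ∈ B} := by
    refine MeasurableSet.inter (MeasurableSet.inter ?_ ?_) (measurable_snd hB)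
    · have : {z : ((ℕ → ℝ) × E × ℝ) × E | ∀ i, z.1.1 i ≤ dist (q i) z.2} =
          ⋂ i, {z : ((ℕ → ℝ) × E × ℝ) × E | z.1.1 i ≤ dist (q i) z.2} := by ext; simp
      change MeasurableSet {z : ((ℕ → ℝ) × E × ℝ) × E | ∀ i, z.1.1 i ≤ dist (q i) z.2}
      rw [this]
      exact .iInter fun i => measurableSet_le (by fun_prop) (by fun_prop)
    · exact measurableSet_le (f := fun z : ((ℕ → ℝ) × E × ℝ) × E => dist z.1.2.1 z.2)
        (g := fun z => z.1.2.2) (by fun_prop) (by fun_prop)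
  convert nullMeasurableSet_exists hh hBm using 1
  ext x
  simp only [Set.mem_preimage, Set.mem_ofPred_eq,
    ← (hcl x).mem_iff_forall_infDist_le_dist (hne x) hq, ← hp]
  simp

end MetricTarget

/-! ### Nearest points in members of 𝒦 -/

namespace ConvexSymmSet

variable {𝕜 : Type*} [RCLike 𝕜] {n : ℕ}

theorem neg_mem (K : ConvexSymmSet 𝕜 n) {u : EuclideanSpace 𝕜 (Fin n)} (hu : u ∈ K.carrier) :
    -u ∈ K.carrier := by
  simpa using K.symm' u hu (-1) (by simp)

theorem zero_mem (K : ConvexSymmSet 𝕜 n) : (0 : EuclideanSpace 𝕜 (Fin n)) ∈ K.carrier := by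
  obtain ⟨u, hu⟩ := K.nonempty'
  have := K.convex' hu (K.neg_mem hu) (a := 1 / 2) (b := 1 / 2) (by norm_num) (by norm_num)
    (by norm_num)
  simpa using this

theorem smul_mem (K : ConvexSymmSet 𝕜 n) {u : EuclideanSpace 𝕜 (Fin n)} (hu : u ∈ K.carrier)
    {t : ℝ} (h0 : 0 ≤ t) (h1 : t ≤ 1) : t • u ∈ K.carrier := by
  have := K.convex' hu K.zero_mem (a := t) (b := 1 - t) h0 (by linarith) (by ring)
  simpa using this

/-- The nearest point of `K` to `q`. -/
def proj (K : ConvexSymmSet 𝕜 n) (q : EuclideanSpace 𝕜 (Fin n)) : EuclideanSpace 𝕜 (Fin n) :=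
  (K.isClosed'.exists_infDist_eq_dist K.nonempty' q).choose

theorem proj_mem (K : ConvexSymmSet 𝕜 n) (q : EuclideanSpace 𝕜 (Fin n)) : K.proj q ∈ K.carrier :=
  (K.isClosed'.exists_infDist_eq_dist K.nonempty' q).choose_spec.1

theorem dist_proj (K : ConvexSymmSet 𝕜 n) (q : EuclideanSpace 𝕜 (Fin n)) :
    dist q (K.proj q) = Metric.infDist q K.carrier :=
  (K.isClosed'.exists_infDist_eq_dist K.nonempty' q).choose_spec.2.symm

/-- The midpoint of two nearest points is in `K` by convexity; by the parallelogram law it would be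
strictly nearer if they were distinct. -/
theorem eq_proj_iff (K : ConvexSymmSet 𝕜 n) (q u : EuclideanSpace 𝕜 (Fin n)) :
    u = K.proj q ↔ u ∈ K.carrier ∧ dist q u ≤ Metric.infDist q K.carrier := by
  refine ⟨?_, fun ⟨hu, hd⟩ => ?_⟩
  · rintro rfl
    exact ⟨K.proj_mem q, (K.dist_proj q).le⟩
  set v := K.proj q with hv
  have hdv : dist q v = Metric.infDist q K.carrier := K.dist_proj q
  have hm : (1 / 2 : ℝ) • u + (1 / 2 : ℝ) • v ∈ K.carrier :=
    K.convex' hu (K.proj_mem q) (by norm_num) (by norm_num) (by norm_num)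
  have hdm := Metric.infDist_le_dist_of_mem (x := q) hm
  have hpar := parallelogram_law_with_norm 𝕜 (q - u) (q - v)
  have h1 : (q - u) + (q - v) = (2 : ℝ) • (q - ((1 / 2 : ℝ) • u + (1 / 2 : ℝ) • v)) := by
    module
  have h2 : (q - u) - (q - v) = v - u := by abel
  rw [h1, h2, norm_smul, ← dist_eq_norm, ← dist_eq_norm q u, ← dist_eq_norm q v, hdv,
    ← dist_eq_norm v u] at hpar
  have hn : (0 : ℝ) ≤ Metric.infDist q K.carrier := Metric.infDist_nonneg
  have h3 : ‖(2 : ℝ)‖ = 2 := by norm_num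
  rw [h3] at hpar
  have hz : dist v u = 0 := by
    have h4 := mul_self_le_mul_self hn hdm
    have h5 := mul_self_le_mul_self dist_nonneg hd
    have h6 : dist v u * dist v u ≤ 0 := by nlinarith
    exact mul_self_eq_zero.1 (le_antisymm h6 (mul_self_nonneg _))
  exact (dist_eq_zero.1 hz).symm

/-- The nearest points to a dense sequence are dense. -/
theorem closure_range_proj (K : ConvexSymmSet 𝕜 n) {ι : Type*}
    {q : ι → EuclideanSpace 𝕜 (Fin n)} (hq : DenseRange q) :
    closure (Set.range fun i => K.proj (q i)) = K.carrier := by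
  refine (closure_minimal (Set.range_subset_iff.2 fun i => K.proj_mem _)
    K.isClosed').antisymm fun u hu => ?_
  refine Metric.mem_closure_range_iff.2 fun ε hε => ?_
  obtain ⟨i, hi⟩ := hq.exists_dist_lt u (half_pos hε)
  refine ⟨i, ?_⟩
  have h1 := K.dist_proj (q i)
  have h2 := Metric.infDist_le_dist_of_mem (x := q i) hu
  rw [dist_comm] at h2
  linarith [dist_triangle u (q i) (K.proj (q i))]

end ConvexSymmSet

/-! ### Measurability criteria for maps into 𝒦 -/

section SetValued

variable {𝕜 : Type*} [RCLike 𝕜] {n : ℕ} {Ω : Type*} [MeasurableSpace Ω] {μ : Measure Ω} [SFinite μ]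
  {F : Ω → ConvexSymmSet 𝕜 n}

theorem SetValuedMeasurable.aemeasurable_proj (hF : SetValuedMeasurable μ F)
    {f : Ω → EuclideanSpace 𝕜 (Fin n)} (hf : AEMeasurable f μ) :
    AEMeasurable (fun x => (F x).proj (f x)) μ :=
  aemeasurable_nearestPoint (fun x => (F x).nonempty') (fun x => (F x).isClosed')
    (aemeasurable_infDist_of_hitting (fun x => (F x).nonempty') hF) hf
    fun x u => (F x).eq_proj_iff (f x) u

/-- Converse of `aemeasurable_infDist_of_hitting`: measurable distances, which only test open balls,
already control all Borel sets, thanks to measurable projection. -/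
theorem setValuedMeasurable_of_infDist
    (hF : ∀ q, AEMeasurable (fun x => Metric.infDist q (F x).carrier) μ) :
    SetValuedMeasurable μ F := by
  intro B hB
  have := nullMeasurableSet_hitting_of_forall_le_dist
    (fun i => hF (TopologicalSpace.denseSeq _ i)) (TopologicalSpace.denseSeq _) hB
  convert this using 5 with x
  ext u
  exact (F x).isClosed'.mem_iff_forall_infDist_le_dist (F x).nonempty'
    (TopologicalSpace.denseRange_denseSeq _) u

/-- A map with a countable family of measurable selections that is pointwise dense is
measurable. -/
theorem setValuedMeasurable_of_closure_range {ι : Type*} [Countable ι]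
    {g : ι → Ω → EuclideanSpace 𝕜 (Fin n)} (hg : ∀ i, AEMeasurable (g i) μ)
    (hF : ∀ x, (F x).carrier = closure (Set.range fun i => g i x)) : SetValuedMeasurable μ F := by
  refine setValuedMeasurable_of_infDist fun q => ?_
  have : ∀ x, Metric.infDist q (F x).carrier = ⨅ i, dist q (g i x) := by
    intro x
    rw [hF, Metric.infDist_closure, Metric.infDist_eq_iInf, iInf_range' (fun u => dist q u)]
  simp_rw [this]
  exact AEMeasurable.iInf fun i => aemeasurable_const.dist (hg i)

/-- Intersections of measurable maps are measurable. -/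
theorem setValuedMeasurable_of_eq_iInter {ι : Type*} [Countable ι]
    {G : ι → Ω → ConvexSymmSet 𝕜 n} (hG : ∀ i, SetValuedMeasurable μ (G i))
    (hF : ∀ x, (F x).carrier = ⋂ i, (G i x).carrier) : SetValuedMeasurable μ F := by
  intro B hB
  have := nullMeasurableSet_hitting_of_forall_le_dist (μ := μ)
    (φ := fun (p : ι × ℕ) x => Metric.infDist (TopologicalSpace.denseSeq _ p.2) (G p.1 x).carrier)
    (fun p => aemeasurable_infDist_of_hitting (fun x => (G p.1 x).nonempty') (hG p.1) _)
    (fun p => TopologicalSpace.denseSeq (EuclideanSpace 𝕜 (Fin n)) p.2) hB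
  convert this using 5 with x
  ext u
  rw [hF, Set.mem_iInter]
  simp only [Set.mem_ofPred_eq, Prod.forall]
  exact forall_congr' fun i => (G i x).isClosed'.mem_iff_forall_infDist_le_dist
    (G i x).nonempty' (TopologicalSpace.denseRange_denseSeq _) u

end SetValued


/-! ### Closed sums, series and shrinking sequences in 𝒦 -/

theorem closure_closure_add_closure {E : Type*} [TopologicalSpace E] [Add E] [ContinuousAdd E]
    (A B : Set E) : closure (closure A + closure B) = closure (A + B) := by
  refine (closure_minimal ?_ isClosed_closure).antisymm
    (closure_mono (Set.add_subset_add subset_closure subset_closure))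
  rintro _ ⟨a, ha, b, hb, rfl⟩
  exact map_mem_closure₂ continuous_add ha hb fun a ha b hb => Set.add_mem_add ha hb

theorem closure_add_closure {E : Type*} [TopologicalSpace E] [Add E] [ContinuousAdd E]
    (A B : Set E) : closure (A + closure B) = closure (A + B) := by
  rw [← closure_closure_add_closure, closure_closure, closure_closure_add_closure]

namespace ConvexSymmSet

variable {𝕜 : Type*} [RCLike 𝕜] {n : ℕ}

/-- The closure of a nonempty convex symmetric set. -/
def ofClosure (s : Set (EuclideanSpace 𝕜 (Fin n))) (hne : s.Nonempty) (hconv : Convex ℝ s)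
    (hsymm : ∀ u ∈ s, ∀ c : 𝕜, ‖c‖ = 1 → c • u ∈ s) : ConvexSymmSet 𝕜 n where
  carrier := closure s
  nonempty' := hne.closure
  isClosed' := isClosed_closure
  convex' := hconv.closure
  symm' _ hu c hc := map_mem_closure (continuous_const_smul c) hu fun v hv => hsymm v hv c hc

/-- The closed Minkowski sum. -/
def add (K L : ConvexSymmSet 𝕜 n) : ConvexSymmSet 𝕜 n :=
  ofClosure (K.carrier + L.carrier) (K.nonempty'.add L.nonempty') (K.convex'.add L.convex') <| by
    rintro _ ⟨u, hu, v, hv, rfl⟩ c hc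
    change c • (u + v) ∈ _
    rw [smul_add]
    exact Set.add_mem_add (K.symm' u hu c hc) (L.symm' v hv c hc)

theorem add_carrier (K L : ConvexSymmSet 𝕜 n) :
    (K.add L).carrier = closure (K.carrier + L.carrier) := rfl

theorem left_subset_add (K L : ConvexSymmSet 𝕜 n) : K.carrier ⊆ (K.add L).carrier := fun u hu =>
  subset_closure ⟨u, hu, 0, L.zero_mem, add_zero u⟩

theorem right_subset_add (K L : ConvexSymmSet 𝕜 n) : L.carrier ⊆ (K.add L).carrier := fun u hu =>
  subset_closure ⟨0, K.zero_mem, u, hu, zero_add u⟩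

/-- Multiples by nonzero reals. -/
def rsmul (c : ℝ) (hc : c ≠ 0) (K : ConvexSymmSet 𝕜 n) : ConvexSymmSet 𝕜 n where
  carrier := c • K.carrier
  nonempty' := K.nonempty'.smul_set
  isClosed' := K.isClosed'.smul_of_ne_zero hc
  convex' := K.convex'.smul c
  symm' := by
    rintro _ ⟨u, hu, rfl⟩ a ha
    exact ⟨a • u, K.symm' u hu a ha, smul_comm c a u⟩

/-- The trivial set. -/
def zero : ConvexSymmSet 𝕜 n where
  carrier := {0}
  nonempty' := Set.singleton_nonempty 0
  isClosed' := isClosed_singleton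
  convex' := convex_singleton 0
  symm' := by
    rintro _ rfl c -
    simp

/-- Partial sums of a sequence. -/
def partialSum : ℕ → (ℕ → ConvexSymmSet 𝕜 n) → ConvexSymmSet 𝕜 n
  | 0, _ => zero
  | N + 1, U => (U 0).add (partialSum N fun k => U (k + 1))

theorem partialSum_mono (U : ℕ → ConvexSymmSet 𝕜 n) :
    Monotone fun N => (partialSum N U).carrier := by
  refine monotone_nat_of_le_succ fun N => ?_
  induction N generalizing U with
  | zero =>
    rintro _ rfl
    exact (partialSum 1 U).zero_mem
  | succ N ih => exact closure_mono (Set.add_subset_add_left (ih fun k => U (k + 1)))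

/-- Sums of sequences, without any assumption of convergence. -/
def infSum (U : ℕ → ConvexSymmSet 𝕜 n) : ConvexSymmSet 𝕜 n :=
  ofClosure (⋃ N, (partialSum N U).carrier) ⟨0, Set.mem_iUnion.2 ⟨0, zero_mem _⟩⟩
    ((partialSum_mono U).directed_le.convex_iUnion fun {N} => (partialSum N U).convex') <| by
      intro u hu c hc
      obtain ⟨N, hN⟩ := Set.mem_iUnion.1 hu
      exact Set.mem_iUnion.2 ⟨N, (partialSum N U).symm' u hN c hc⟩

theorem infSum_carrier (U : ℕ → ConvexSymmSet 𝕜 n) :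
    (infSum U).carrier = closure (⋃ N, (partialSum N U).carrier) := rfl

/-- Partial sums are built by adding a new head to the shifted sequence, so splitting off the first
term needs no reordering, only an index shift in the union. -/
theorem infSum_succ (U : ℕ → ConvexSymmSet 𝕜 n) :
    (infSum U).carrier = closure ((U 0).carrier + (infSum fun k => U (k + 1)).carrier) := by
  rw [infSum_carrier, infSum_carrier, closure_add_closure, Set.add_iUnion]
  refine (closure_minimal (Set.iUnion_subset fun N => ?_) isClosed_closure).antisymm
    (closure_mono (Set.iUnion_subset fun N => ?_))
  · exact (partialSum_mono U N.le_succ).trans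
      (closure_mono (Set.subset_iUnion (fun N => (U 0).carrier +
        (partialSum N fun k => U (k + 1)).carrier) N))
  · exact subset_closure.trans (Set.subset_iUnion (fun N => (partialSum N U).carrier) (N + 1))

theorem head_subset_infSum (U : ℕ → ConvexSymmSet 𝕜 n) : (U 0).carrier ⊆ (infSum U).carrier := by
  rw [infSum_succ]
  exact left_subset_add (U 0) (infSum fun k => U (k + 1))

theorem tail_subset_infSum (U : ℕ → ConvexSymmSet 𝕜 n) :
    (infSum fun k => U (k + 1)).carrier ⊆ (infSum U).carrier := by
  rw [infSum_succ U]
  exact right_subset_add (U 0) (infSum fun k => U (k + 1))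

/-- Intersections. -/
def iInter {ι : Sort*} (U : ι → ConvexSymmSet 𝕜 n) : ConvexSymmSet 𝕜 n where
  carrier := ⋂ i, (U i).carrier
  nonempty' := ⟨0, Set.mem_iInter.2 fun i => (U i).zero_mem⟩
  isClosed' := isClosed_iInter fun i => (U i).isClosed'
  convex' := convex_iInter fun i => (U i).convex'
  symm' u hu c hc := Set.mem_iInter.2 fun i => (U i).symm' u (Set.mem_iInter.1 hu i) c hc

/-- A decreasing sequence in `𝒦` with trivial intersection shrinks to `0`. -/
theorem exists_subset_ball_of_iInter_eq (W : ℕ → ConvexSymmSet 𝕜 n)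
    (hW : Antitone fun j => (W j).carrier) (h0 : ⋂ j, (W j).carrier = {0}) {ε : ℝ} (hε : 0 < ε) :
    ∃ j, (W j).carrier ⊆ Metric.ball 0 ε := by
  by_contra! h
  simp only [Set.not_subset, Metric.mem_ball, dist_zero_right, not_lt] at h
  have hne : (⋂ j, (W j).carrier ∩ Metric.sphere 0 ε).Nonempty := by
    refine IsCompact.nonempty_iInter_of_sequence_nonempty_isCompact_isClosed _
      (fun j => Set.inter_subset_inter_left _ (hW j.le_succ)) (fun j => ?_)
      ((isCompact_sphere _ _).inter_left (W 0).isClosed')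
      (fun j => (W j).isClosed'.inter Metric.isClosed_sphere)
    obtain ⟨u, hu, hεu⟩ := h j
    have hu0 : 0 < ‖u‖ := hε.trans_le hεu
    -- A point outside the ball is pulled back radially to the sphere; it stays in the set, which is
    -- convex and contains `0`.
    refine ⟨(ε / ‖u‖) • u, (W j).smul_mem hu (by positivity) ((div_le_one hu0).2 hεu), ?_⟩
    rw [mem_sphere_zero_iff_norm, norm_smul, Real.norm_of_nonneg (by positivity),
      div_mul_cancel₀ _ hu0.ne']
  obtain ⟨u, hu⟩ := hne
  rw [Set.mem_iInter] at hu
  have hu0 : u ∈ ⋂ j, (W j).carrier := Set.mem_iInter.2 fun j => (hu j).1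
  rw [h0] at hu0
  have := (hu 0).2
  rw [mem_sphere_zero_iff_norm, Set.mem_singleton_iff.1 hu0, norm_zero] at this
  exact hε.ne this

/-- Perturbations by sets shrinking to `0` do not enlarge a closed set. -/
theorem mem_of_forall_mem_closure_add (W : ℕ → ConvexSymmSet 𝕜 n)
    (hW : Antitone fun j => (W j).carrier) (h0 : ⋂ j, (W j).carrier = {0})
    {A : Set (EuclideanSpace 𝕜 (Fin n))} (hA : IsClosed A) {u : EuclideanSpace 𝕜 (Fin n)}
    (hu : ∀ j, u ∈ closure (A + (W j).carrier)) : u ∈ A := by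
  refine hA.closure_subset (Metric.mem_closure_iff.2 fun ε hε => ?_)
  obtain ⟨j, hj⟩ := exists_subset_ball_of_iInter_eq W hW h0 (half_pos hε)
  obtain ⟨_, ⟨a, ha, w, hw, rfl⟩, hd⟩ := Metric.mem_closure_iff.1 (hu j) _ (half_pos hε)
  refine ⟨a, ha, ?_⟩
  have h1 := hj hw
  rw [mem_ball_zero_iff] at h1
  have h2 : dist (a + w) a = ‖w‖ := by simp [dist_eq_norm]
  linarith [dist_triangle u (a + w) a]

end ConvexSymmSet

/-! ### Measurability of sums and series -/

section Measurability

variable {𝕜 : Type*} [RCLike 𝕜] {n : ℕ} {Ω : Type*} [MeasurableSpace Ω] {μ : Measure Ω}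

theorem SetValuedMeasurable.zero :
    SetValuedMeasurable μ (fun _ => (ConvexSymmSet.zero : ConvexSymmSet 𝕜 n)) := fun B _ => by
  by_cases h : (((ConvexSymmSet.zero : ConvexSymmSet 𝕜 n) :
      Set (EuclideanSpace 𝕜 (Fin n))) ∩ B).Nonempty <;> simp [h]

theorem SetValuedMeasurable.rsmul {F : Ω → ConvexSymmSet 𝕜 n} (hF : SetValuedMeasurable μ F)
    {c : ℝ} (hc : c ≠ 0) : SetValuedMeasurable μ (fun x => (F x).rsmul c hc) := by
  intro B hB
  convert hF ((fun u => c • u) ⁻¹' B) (measurable_const_smul c hB) using 3 with x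
  change (c • (F x).carrier ∩ B).Nonempty ↔ _
  constructor
  · rintro ⟨_, ⟨u, hu, rfl⟩, h⟩
    exact ⟨u, hu, h⟩
  · rintro ⟨u, hu, h⟩
    exact ⟨c • u, ⟨u, hu, rfl⟩, h⟩

variable [SFinite μ]

theorem SetValuedMeasurable.add {F G : Ω → ConvexSymmSet 𝕜 n} (hF : SetValuedMeasurable μ F)
    (hG : SetValuedMeasurable μ G) : SetValuedMeasurable μ (fun x => (F x).add (G x)) := by
  set q := TopologicalSpace.denseSeq (EuclideanSpace 𝕜 (Fin n))
  have hq : DenseRange q := TopologicalSpace.denseRange_denseSeq _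
  refine setValuedMeasurable_of_closure_range
    (g := fun (p : ℕ × ℕ) x => (F x).proj (q p.1) + (G x).proj (q p.2)) (fun p =>
      (hF.aemeasurable_proj aemeasurable_const).add (hG.aemeasurable_proj aemeasurable_const))
    fun x => ?_
  rw [ConvexSymmSet.add_carrier, ← (F x).closure_range_proj hq, ← (G x).closure_range_proj hq,
    closure_closure_add_closure, ← Set.image2_add, Set.image2_range]

theorem SetValuedMeasurable.partialSum {U : ℕ → Ω → ConvexSymmSet 𝕜 n}
    (hU : ∀ k, SetValuedMeasurable μ (U k)) (N : ℕ) :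
    SetValuedMeasurable μ (fun x => ConvexSymmSet.partialSum N fun k => U k x) := by
  induction N generalizing U with
  | zero => exact SetValuedMeasurable.zero
  | succ N ih => exact (hU 0).add (ih fun k => hU (k + 1))

theorem SetValuedMeasurable.infSum {U : ℕ → Ω → ConvexSymmSet 𝕜 n}
    (hU : ∀ k, SetValuedMeasurable μ (U k)) :
    SetValuedMeasurable μ (fun x => ConvexSymmSet.infSum fun k => U k x) := by
  set q := TopologicalSpace.denseSeq (EuclideanSpace 𝕜 (Fin n))
  have hq : DenseRange q := TopologicalSpace.denseRange_denseSeq _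
  refine setValuedMeasurable_of_closure_range
    (g := fun (p : ℕ × ℕ) x => (ConvexSymmSet.partialSum p.1 fun k => U k x).proj (q p.2))
    (fun p => (SetValuedMeasurable.partialSum hU p.1).aemeasurable_proj aemeasurable_const)
    fun x => ?_
  rw [ConvexSymmSet.infSum_carrier]
  refine (closure_minimal (Set.iUnion_subset fun N => ?_) isClosed_closure).antisymm
    (closure_mono (Set.range_subset_iff.2 fun p => Set.mem_iUnion.2
      ⟨p.1, ConvexSymmSet.proj_mem _ _⟩))
  rw [← ConvexSymmSet.closure_range_proj _ hq]
  exact closure_mono (Set.range_subset_iff.2 fun i => ⟨(N, i), rfl⟩)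

end Measurability

/-! ### Measurable approximation by selections -/

section Selection

variable {Ω E : Type*} [MeasurableSpace Ω] {μ : Measure Ω} [MetricSpace E]
  [SecondCountableTopology E] [MeasurableSpace E] [BorelSpace E]

/-- Measurable choice of approximants from a pointwise dense sequence of functions. -/
theorem exists_index_dist_lt {g : ℕ → Ω → E} (hg : ∀ i, AEMeasurable (g i) μ) {f : Ω → E}
    (hf : AEMeasurable f μ) (hfg : ∀ᵐ x ∂μ, f x ∈ closure (Set.range fun i => g i x)) {ε : ℝ}
    (hε : 0 < ε) : ∃ k : Ω → ℕ, (∀ i, NullMeasurableSet {x | k x = i} μ) ∧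
      ∀ᵐ x ∂μ, dist (f x) (g (k x) x) < ε := by
  classical
  -- The second alternative makes `Nat.find` defined also on the null set where no approximant
  -- exists.
  let p : Ω → ℕ → Prop := fun x i => dist (f x) (g i x) < ε ∨ ∀ j, ε ≤ dist (f x) (g j x)
  have hp : ∀ x, ∃ i, p x i := by
    intro x
    by_cases h : ∃ i, dist (f x) (g i x) < ε
    · exact h.imp fun i hi => Or.inl hi
    · push Not at h
      exact ⟨0, Or.inr h⟩
  have hlt : ∀ i, NullMeasurableSet {x | dist (f x) (g i x) < ε} μ := fun i =>
    nullMeasurableSet_lt (hf.dist (hg i)) aemeasurable_const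
  have hle : NullMeasurableSet {x | ∀ j, ε ≤ dist (f x) (g j x)} μ := by
    have : {x | ∀ j, ε ≤ dist (f x) (g j x)} = ⋂ j, {x | ε ≤ dist (f x) (g j x)} := by ext; simp
    rw [this]
    exact .iInter fun j => nullMeasurableSet_le aemeasurable_const (hf.dist (hg j))
  have hfind : @Measurable (NullMeasurableSpace Ω μ) ℕ _ _ fun x => Nat.find (hp x) :=
    @measurable_find (NullMeasurableSpace Ω μ) _ p _ hp fun i => (hlt i).union hle
  refine ⟨fun x => Nat.find (hp x), fun i => hfind (measurableSet_singleton i), ?_⟩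
  filter_upwards [hfg] with x hx
  refine (Nat.find_spec (hp x)).resolve_right fun h => ?_
  obtain ⟨i, hi⟩ := Metric.mem_closure_range_iff.1 hx ε hε
  exact absurd (h i) (not_le.2 hi)

end Selection


/-! ### Selections of classes of maps -/

namespace L0K

variable {𝕜 : Type*} [RCLike 𝕜] {n : ℕ} {Ω : Type*} [MeasurableSpace Ω] {μ : Measure Ω}

theorem zero_mem_val (F : L0K 𝕜 n μ) (x : Ω) : (0 : EuclideanSpace 𝕜 (Fin n)) ∈ F.val x :=
  (F.rep x).zero_mem

theorem isClosed_val (F : L0K 𝕜 n μ) (x : Ω) : IsClosed (F.val x) := (F.rep x).isClosed'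

theorem val_mk {F : Ω → ConvexSymmSet 𝕜 n} (hF : SetValuedMeasurable μ F) :
    ∀ᵐ x ∂μ, (mk F hF).val x = (F x).carrier := by
  filter_upwards [rep_mk F hF] with x hx
  rw [val, hx]

variable [SFinite μ]

/-- The selection of `F` that is nearest to a given function. -/
def nearest (F : L0K 𝕜 n μ) (f : Ω →ₘ[μ] EuclideanSpace 𝕜 (Fin n)) :
    Ω →ₘ[μ] EuclideanSpace 𝕜 (Fin n) :=
  AEEqFun.mk (fun x => (F.rep x).proj (f x))
    (F.measurable_rep.aemeasurable_proj f.aemeasurable).aestronglyMeasurable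

theorem coeFn_nearest (F : L0K 𝕜 n μ) (f : Ω →ₘ[μ] EuclideanSpace 𝕜 (Fin n)) :
    ∀ᵐ x ∂μ, F.nearest f x = (F.rep x).proj (f x) := AEEqFun.coeFn_mk _ _

theorem nearest_mem (F : L0K 𝕜 n μ) (f : Ω →ₘ[μ] EuclideanSpace 𝕜 (Fin n)) :
    F.nearest f ∈ F.selections := by
  filter_upwards [F.coeFn_nearest f] with x hx
  rw [hx]
  exact ConvexSymmSet.proj_mem _ _

/-- A map is trivial as soon as its selections are. -/
theorem val_eq_zero_of_selections (F : L0K 𝕜 n μ) (h : ∀ f ∈ F.selections, f = 0) :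
    ∀ᵐ x ∂μ, F.val x = {0} := by
  set q := TopologicalSpace.denseSeq (EuclideanSpace 𝕜 (Fin n))
  have hq : DenseRange q := TopologicalSpace.denseRange_denseSeq _
  have hz : ∀ᵐ x ∂μ, ∀ i, (F.rep x).proj (q i) = 0 := by
    refine ae_all_iff.2 fun i => ?_
    have h1 := h _ (F.nearest_mem (AEEqFun.const Ω (q i)))
    filter_upwards [F.coeFn_nearest (AEEqFun.const Ω (q i)), AEEqFun.coeFn_const (μ := μ) Ω (q i),
      AEEqFun.coeFn_zero (μ := μ) (α := Ω) (β := EuclideanSpace 𝕜 (Fin n))] with x hx hc h0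
    rw [h1, h0, hc] at hx
    exact hx.symm
  filter_upwards [hz] with x hx
  rw [val, ← (F.rep x).closure_range_proj hq]
  simp [hx]

end L0K

/-! ### Norm bounds for selections, from the Fatou property -/

namespace DirectionalBFS

variable {𝕜 : Type*} [RCLike 𝕜] {n : ℕ} {Ω : Type*} [MeasurableSpace Ω] {μ : Measure Ω}

/-- The selections of `F` lie in the ball of radius `C` of `X`. -/
def SelectionsBoundedBy (X : DirectionalBFS 𝕜 n μ) (F : L0K 𝕜 n μ) (C : ℝ) : Prop :=
  ∀ f ∈ F.selections, ∃ hf : f ∈ X.carrier, X.norm ⟨f, hf⟩ ≤ C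

variable {X : DirectionalBFS 𝕜 n μ}

theorem FatouProperty.exists_norm_le (hX : X.FatouProperty) {f : ℕ → X.carrier}
    {g : Ω →ₘ[μ] EuclideanSpace 𝕜 (Fin n)} {C : ℝ} (hC : ∀ k, X.norm (f k) ≤ C)
    (hlim : ∀ᵐ x ∂μ,
      Tendsto (fun k => (f k : Ω →ₘ[μ] EuclideanSpace 𝕜 (Fin n)) x) atTop (𝓝 (g x))) :
    ∃ hg : g ∈ X.carrier, X.norm ⟨g, hg⟩ ≤ C := by
  have hle : liminf (fun k => ENNReal.ofReal (X.norm (f k))) atTop ≤ ENNReal.ofReal C :=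
    liminf_le_of_frequently_le' (Frequently.of_forall fun k => ENNReal.ofReal_le_ofReal (hC k))
  obtain ⟨hg, h⟩ := hX f g hlim (hle.trans_lt ENNReal.ofReal_lt_top)
  exact ⟨hg, (ENNReal.ofReal_le_ofReal_iff ((apply_nonneg X.norm (f 0)).trans (hC 0))).1
    (h.trans hle)⟩

namespace ConvexSpace

theorem zero_mem_selections (F : L0K 𝕜 n μ) : (0 : Ω →ₘ[μ] EuclideanSpace 𝕜 (Fin n)) ∈
    F.selections := by
  filter_upwards [AEEqFun.coeFn_zero (μ := μ) (α := Ω) (β := EuclideanSpace 𝕜 (Fin n))] with x hx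
  rw [hx]
  exact F.zero_mem_val x

theorem norm_le {F : X.ConvexSpace} {C : ℝ} (h : X.SelectionsBoundedBy F.toL0K C) :
    F.norm ≤ C := by
  refine csSup_le ⟨X.norm 0, 0, zero_mem_selections F.toL0K, rfl⟩ ?_
  rintro _ ⟨f, hf, rfl⟩
  exact (h _ hf).2

theorem selectionsBoundedBy_norm (F : X.ConvexSpace) :
    X.SelectionsBoundedBy F.toL0K F.norm := by
  intro f hf
  obtain ⟨C, hC⟩ := F.2
  obtain ⟨hfX, -⟩ := hC f hf
  refine ⟨hfX, le_csSup ⟨C, ?_⟩ ⟨⟨f, hfX⟩, hf, rfl⟩⟩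
  rintro _ ⟨g, hg, rfl⟩
  exact (hC _ hg).2

theorem norm_nonneg (F : X.ConvexSpace) : 0 ≤ F.norm := by
  obtain ⟨h, hn⟩ := F.selectionsBoundedBy_norm _ (zero_mem_selections F.toL0K)
  exact (apply_nonneg X.norm _).trans hn

variable [SFinite μ]

/-- The norm of `X[𝒦]` vanishes only at `{0}`. -/
theorem ae_eq_zero_of_norm_nonpos (F : X.ConvexSpace) (hF : F.norm ≤ 0) : ∀ᵐ x ∂μ, F x = {0} := by
  refine F.toL0K.val_eq_zero_of_selections fun f hf => ?_
  obtain ⟨hfX, hn⟩ := F.selectionsBoundedBy_norm f hf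
  have := X.eq_zero_of_norm ⟨f, hfX⟩ (le_antisymm (hn.trans hF) (apply_nonneg X.norm _))
  exact congrArg Subtype.val this

end ConvexSpace

namespace SelectionsBoundedBy

theorem rsmul {F H : L0K 𝕜 n μ} {C c : ℝ} (hc : 0 < c) (hF : X.SelectionsBoundedBy F C)
    (hH : ∀ᵐ x ∂μ, H.val x = c • F.val x) : X.SelectionsBoundedBy H (c * C) := by
  intro f hf
  have hsel : (c⁻¹ : 𝕜) • f ∈ F.selections := by
    filter_upwards [hf, hH, AEEqFun.coeFn_smul (c⁻¹ : 𝕜) f] with x hx hHx hs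
    rw [hs]
    rw [hHx] at hx
    obtain ⟨u, hu, hux⟩ := hx
    have : ((c⁻¹ : 𝕜) • (f : Ω → EuclideanSpace 𝕜 (Fin n))) x = u := by
      rw [Pi.smul_apply, ← hux]
      change (c : 𝕜)⁻¹ • (c • u) = u
      rw [RCLike.real_smul_eq_coe_smul (K := 𝕜) c u,
        inv_smul_smul₀ (RCLike.ofReal_ne_zero.2 hc.ne')]
    rwa [this]
  obtain ⟨hm, hn⟩ := hF _ hsel
  have hcne : (c : 𝕜) ≠ 0 := RCLike.ofReal_ne_zero.2 hc.ne'
  have hf' : f = (c : 𝕜) • ((c⁻¹ : 𝕜) • f) := (smul_inv_smul₀ hcne f).symm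
  have hfX : f ∈ X.carrier := hf' ▸ X.carrier.smul_mem (c : 𝕜) hm
  refine ⟨hfX, ?_⟩
  have heq : (⟨f, hfX⟩ : X.carrier) = (c : 𝕜) • ⟨_, hm⟩ := Subtype.ext hf'
  rw [heq, map_smul_eq_mul, RCLike.norm_ofReal, abs_of_pos hc]
  exact mul_le_mul_of_nonneg_left hn hc.le

variable [SFinite μ]

/-- A selection of a closed sum need not split into selections of the summands. It is an a.e. limit
of sums that do, each of norm at most `C + D`, and the Fatou property passes to the limit. -/
theorem add (hX : X.FatouProperty) {F G H : L0K 𝕜 n μ} {C D : ℝ}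
    (hF : X.SelectionsBoundedBy F C) (hG : X.SelectionsBoundedBy G D)
    (hH : ∀ᵐ x ∂μ, H.val x = closure (F.val x + G.val x)) : X.SelectionsBoundedBy H (C + D) := by
  intro f hf
  set q := TopologicalSpace.denseSeq (EuclideanSpace 𝕜 (Fin n))
  have hq : DenseRange q := TopologicalSpace.denseRange_denseSeq _
  -- Pairs of indices are coded by one natural number, so that a single least index selects both
  -- summands.
  have ha : ∀ i : ℕ, AEMeasurable (fun x => (F.rep x).proj (q i.unpair.1)) μ := fun i =>
    F.measurable_rep.aemeasurable_proj aemeasurable_const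
  have hb : ∀ i : ℕ, AEMeasurable (fun x => (G.rep x).proj (q i.unpair.2)) μ := fun i =>
    G.measurable_rep.aemeasurable_proj aemeasurable_const
  have hcl : ∀ᵐ x ∂μ, f x ∈ closure (Set.range fun i : ℕ =>
      (F.rep x).proj (q i.unpair.1) + (G.rep x).proj (q i.unpair.2)) := by
    filter_upwards [hf, hH] with x hx hHx
    rw [hHx, L0K.val, L0K.val, ← (F.rep x).closure_range_proj hq,
      ← (G.rep x).closure_range_proj hq, closure_closure_add_closure, ← Set.image2_add,
      Set.image2_range] at hx
    refine closure_mono ?_ hx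
    rintro _ ⟨p, rfl⟩
    exact ⟨Nat.pair p.1 p.2, by simp⟩
  have hex : ∀ k : ℕ, ∃ a ∈ F.selections, ∃ b ∈ G.selections,
      ∀ᵐ x ∂μ, dist ((a + b : Ω →ₘ[μ] EuclideanSpace 𝕜 (Fin n)) x) (f x) < 1 / ((k : ℝ) + 1) := by
    intro k
    obtain ⟨idx, hidx, hd⟩ := exists_index_dist_lt (fun i => (ha i).add (hb i)) f.aemeasurable hcl
      (Nat.one_div_pos_of_nat (α := ℝ) (n := k))
    have hma := (aemeasurable_comp_index ha hidx).aestronglyMeasurable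
    have hmb := (aemeasurable_comp_index hb hidx).aestronglyMeasurable
    refine ⟨AEEqFun.mk _ hma, ?_, AEEqFun.mk _ hmb, ?_, ?_⟩
    · filter_upwards [AEEqFun.coeFn_mk _ hma] with x hx
      rw [hx]
      exact ConvexSymmSet.proj_mem _ _
    · filter_upwards [AEEqFun.coeFn_mk _ hmb] with x hx
      rw [hx]
      exact ConvexSymmSet.proj_mem _ _
    · filter_upwards [AEEqFun.coeFn_mk _ hma, AEEqFun.coeFn_mk _ hmb, hd,
        AEEqFun.coeFn_add (AEEqFun.mk _ hma) (AEEqFun.mk _ hmb)] with x hxa hxb hxd hadd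
      rw [hadd, Pi.add_apply, hxa, hxb, dist_comm]
      exact hxd
  choose a haF b hbG hd using hex
  choose haX hna using fun k => hF _ (haF k)
  choose hbX hnb using fun k => hG _ (hbG k)
  refine hX.exists_norm_le (f := fun k => ⟨a k, haX k⟩ + ⟨b k, hbX k⟩) (fun k =>
    (map_add_le_add X.norm _ _).trans (add_le_add (hna k) (hnb k))) ?_
  filter_upwards [ae_all_iff.2 hd] with x hx
  exact tendsto_iff_dist_tendsto_zero.2 (squeeze_zero (fun _ => dist_nonneg) (fun k => (hx k).le)
    tendsto_one_div_add_atTop_nhds_zero_nat)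

/-- The nearest selections of `P N` to a selection `f` of `H` converge to `f` a.e., because the sets
increase to a dense subset of `H`. -/
theorem iUnion (hX : X.FatouProperty) {P : ℕ → L0K 𝕜 n μ} {H : L0K 𝕜 n μ} {C : ℝ}
    (hP : ∀ N, X.SelectionsBoundedBy (P N) C) (hmono : ∀ᵐ x ∂μ, Monotone fun N => (P N).val x)
    (hH : ∀ᵐ x ∂μ, H.val x = closure (⋃ N, (P N).val x)) : X.SelectionsBoundedBy H C := by
  intro f hf
  choose hfX hn using fun N => hP N _ ((P N).nearest_mem f)
  refine hX.exists_norm_le (f := fun N => ⟨(P N).nearest f, hfX N⟩) hn ?_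
  filter_upwards [hf, hmono, hH, ae_all_iff.2 fun N => (P N).coeFn_nearest f] with x hx hm hHx hp
  rw [hHx] at hx
  refine Metric.tendsto_atTop.2 fun ε hε => ?_
  obtain ⟨u, hu, hd⟩ := Metric.mem_closure_iff.1 hx ε hε
  obtain ⟨N, hN⟩ := Set.mem_iUnion.1 hu
  refine ⟨N, fun k hk => ?_⟩
  change dist ((P k).nearest f x) (f x) < ε
  rw [hp k, dist_comm, ConvexSymmSet.dist_proj]
  exact (Metric.infDist_le_dist_of_mem (hm hk hN)).trans_lt hd

end SelectionsBoundedBy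

end DirectionalBFS


/-! ### Series in X[𝒦] and scaled iterates -/

namespace L0K

variable {𝕜 : Type*} [RCLike 𝕜] {n : ℕ} {Ω : Type*} [MeasurableSpace Ω] {μ : Measure Ω}

/-- Multiples by nonzero reals. -/
def rsmul (c : ℝ) (hc : c ≠ 0) (F : L0K 𝕜 n μ) : L0K 𝕜 n μ :=
  mk (fun x => (F.rep x).rsmul c hc) (F.measurable_rep.rsmul hc)

theorem val_rsmul (c : ℝ) (hc : c ≠ 0) (F : L0K 𝕜 n μ) :
    ∀ᵐ x ∂μ, (F.rsmul c hc).val x = c • F.val x := val_mk _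

variable [SFinite μ]

/-- Partial sums of a sequence of set-valued maps. -/
def partialSum (N : ℕ) (U : ℕ → L0K 𝕜 n μ) : L0K 𝕜 n μ :=
  mk (fun x => ConvexSymmSet.partialSum N fun k => (U k).rep x)
    (SetValuedMeasurable.partialSum (fun k => (U k).measurable_rep) N)

theorem val_partialSum (N : ℕ) (U : ℕ → L0K 𝕜 n μ) : ∀ᵐ x ∂μ,
    (partialSum N U).val x = (ConvexSymmSet.partialSum N fun k => (U k).rep x).carrier := val_mk _

/-- The pointwise sum of a sequence of set-valued maps. -/
def infSum (U : ℕ → L0K 𝕜 n μ) : L0K 𝕜 n μ :=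
  mk (fun x => ConvexSymmSet.infSum fun k => (U k).rep x)
    (SetValuedMeasurable.infSum fun k => (U k).measurable_rep)

theorem val_infSum (U : ℕ → L0K 𝕜 n μ) : ∀ᵐ x ∂μ,
    (infSum U).val x = (ConvexSymmSet.infSum fun k => (U k).rep x).carrier := val_mk _

theorem val_infSum_succ (U : ℕ → L0K 𝕜 n μ) : ∀ᵐ x ∂μ,
    (infSum U).val x = closure ((U 0).val x + (infSum fun k => U (k + 1)).val x) := by
  filter_upwards [val_infSum U, val_infSum fun k => U (k + 1)] with x h1 h2
  rw [h1, h2]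
  exact ConvexSymmSet.infSum_succ _

end L0K

namespace DirectionalBFS

variable {𝕜 : Type*} [RCLike 𝕜] {n : ℕ} {Ω : Type*} [MeasurableSpace Ω] {μ : Measure Ω}
  {X : DirectionalBFS 𝕜 n μ}

namespace ConvexSpace

/-- Multiples of members of `X[𝒦]` by positive reals. -/
def rsmul (c : ℝ) (hc : 0 < c) (F : X.ConvexSpace) : X.ConvexSpace :=
  ⟨F.toL0K.rsmul c hc.ne', c * F.norm,
    F.selectionsBoundedBy_norm.rsmul hc (F.toL0K.val_rsmul c hc.ne')⟩

theorem rsmul_apply (c : ℝ) (hc : 0 < c) (F : X.ConvexSpace) :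
    ∀ᵐ x ∂μ, F.rsmul c hc x = c • F x := F.toL0K.val_rsmul c hc.ne'

theorem norm_rsmul_le (c : ℝ) (hc : 0 < c) (F : X.ConvexSpace) :
    (F.rsmul c hc).norm ≤ c * F.norm :=
  norm_le (F.selectionsBoundedBy_norm.rsmul hc (F.toL0K.val_rsmul c hc.ne'))

end ConvexSpace

theorem opNorm_nonneg (T : X.ConvexSpace → X.ConvexSpace) : 0 ≤ opNorm T :=
  Real.sInf_nonneg fun _ h => h.1

theorem opNorm_le {T : X.ConvexSpace → X.ConvexSpace} {C : ℝ} (hC : 0 ≤ C)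
    (h : ∀ F, (T F).norm ≤ C * F.norm) : opNorm T ≤ C :=
  csInf_le ⟨0, fun _ h => h.1⟩ ⟨hC, h⟩

/-- The infimum is attained: divide by the norm of `F` if it is positive; if it is zero, any
admissible constant already gives the bound. -/
theorem IsBoundedOp.norm_le_opNorm_mul {T : X.ConvexSpace → X.ConvexSpace} (hT : IsBoundedOp T)
    (F : X.ConvexSpace) : (T F).norm ≤ opNorm T * F.norm := by
  obtain ⟨C, hC0, hC⟩ := hT
  rcases F.norm_nonneg.eq_or_lt with h0 | hpos
  · have := hC F
    rw [← h0, mul_zero] at this ⊢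
    exact this
  · rw [← div_le_iff₀ hpos]
    exact le_csInf ⟨C, hC0, hC⟩ fun D hD => (div_le_iff₀ hpos).2 (hD.2 F)

section ScaledIterate

variable (T : X.ConvexSpace → X.ConvexSpace) (c : ℝ) (hc : 0 < c)

/-- The iterates `F, c T F, c T (c T F), …`. -/
def scaledIterate (F : X.ConvexSpace) : ℕ → X.ConvexSpace
  | 0 => F
  | k + 1 => (T (scaledIterate F k)).rsmul c hc

variable {T c}

theorem norm_scaledIterate_le (hT : ∀ F, c * (T F).norm ≤ 1 / 2 * F.norm) (F : X.ConvexSpace)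
    (k : ℕ) : (scaledIterate T c hc F k).norm ≤ F.norm * (1 / 2) ^ k := by
  induction k with
  | zero => simp [scaledIterate]
  | succ k ih =>
    have h1 := (T (scaledIterate T c hc F k)).norm_rsmul_le c hc
    have h2 := hT (scaledIterate T c hc F k)
    change ((T (scaledIterate T c hc F k)).rsmul c hc).norm ≤ _
    rw [pow_succ]
    linarith

theorem summable_norm_scaledIterate (hT : ∀ F, c * (T F).norm ≤ 1 / 2 * F.norm)
    (F : X.ConvexSpace) (j : ℕ) : Summable fun k => (scaledIterate T c hc F (k + j)).norm := by
  have hs : Summable fun k => (scaledIterate T c hc F k).norm :=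
    Summable.of_nonneg_of_le (fun k => ConvexSpace.norm_nonneg _)
      (fun k => norm_scaledIterate_le hc hT F k) (summable_geometric_two.mul_left F.norm)
  exact (summable_nat_add_iff (f := fun k => (scaledIterate T c hc F k).norm) j).2 hs

end ScaledIterate

variable [SFinite μ]

namespace SelectionsBoundedBy

theorem partialSum (hX : X.FatouProperty) {U : ℕ → L0K 𝕜 n μ} {C : ℕ → ℝ}
    (hU : ∀ k, X.SelectionsBoundedBy (U k) (C k)) (N : ℕ) :
    X.SelectionsBoundedBy (L0K.partialSum N U) (∑ k ∈ Finset.range N, C k) := by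
  induction N generalizing U C with
  | zero =>
    intro f hf
    have : f = 0 := by
      refine AEEqFun.ext ?_
      filter_upwards [hf, L0K.val_partialSum 0 U, AEEqFun.coeFn_zero (μ := μ) (α := Ω)
        (β := EuclideanSpace 𝕜 (Fin n))] with x hx hv h0
      rw [hv] at hx
      rw [h0]
      exact hx
    subst this
    exact ⟨X.carrier.zero_mem, (map_zero X.norm).le⟩
  | succ N ih =>
    rw [Finset.sum_range_succ', add_comm (Finset.sum _ _)]
    refine SelectionsBoundedBy.add hX (hU 0) (ih fun k => hU (k + 1)) ?_
    filter_upwards [L0K.val_partialSum (N + 1) U, L0K.val_partialSum N fun k => U (k + 1)]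
      with x h1 h2
    rw [h1, h2]
    rfl

theorem infSum (hX : X.FatouProperty) {U : ℕ → L0K 𝕜 n μ} {C : ℕ → ℝ}
    (hU : ∀ k, X.SelectionsBoundedBy (U k) (C k)) (hC : Summable C) (hC0 : ∀ k, 0 ≤ C k) :
    X.SelectionsBoundedBy (L0K.infSum U) (∑' k, C k) := by
  have hv := ae_all_iff.2 fun N => L0K.val_partialSum N U
  refine iUnion hX (P := fun N => L0K.partialSum N U) (fun N f hf => ?_) ?_ ?_
  · obtain ⟨hfX, hn⟩ := partialSum hX hU N f hf
    exact ⟨hfX, hn.trans (hC.sum_le_tsum _ fun k _ => hC0 k)⟩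
  · filter_upwards [hv] with x hx
    simp_rw [hx]
    exact ConvexSymmSet.partialSum_mono _
  · filter_upwards [hv, L0K.val_infSum U] with x hx hs
    simp_rw [hx, hs]
    rfl

end SelectionsBoundedBy

namespace ConvexSpace

/-- The sum of an absolutely convergent series in `X[𝒦]`. -/
def infSum (hX : X.FatouProperty) (U : ℕ → X.ConvexSpace) (hU : Summable fun k => (U k).norm) :
    X.ConvexSpace :=
  ⟨L0K.infSum fun k => (U k).toL0K, ∑' k, (U k).norm,
    SelectionsBoundedBy.infSum hX (fun k => (U k).selectionsBoundedBy_norm) hU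
      fun k => (U k).norm_nonneg⟩

theorem norm_infSum_le (hX : X.FatouProperty) (U : ℕ → X.ConvexSpace)
    (hU : Summable fun k => (U k).norm) : (infSum hX U hU).norm ≤ ∑' k, (U k).norm :=
  norm_le <|
    SelectionsBoundedBy.infSum hX (fun k => (U k).selectionsBoundedBy_norm) hU fun k => (U k).norm_nonneg

/-- Almost everywhere, perturbations along an absolutely convergent series in `X[𝒦]` do not enlarge
closed sets. -/
theorem ae_mem_of_forall_mem_closure_add (hX : X.FatouProperty) (U : ℕ → X.ConvexSpace)
    (hU : Summable fun k => (U k).norm) :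
    ∀ᵐ x ∂μ, ∀ A : Set (EuclideanSpace 𝕜 (Fin n)), IsClosed A →
      ∀ u, (∀ j, u ∈ closure (A + U j x)) → u ∈ A := by
  let W : ℕ → Ω → ConvexSymmSet 𝕜 n := fun j x =>
    ConvexSymmSet.infSum fun k => (U (k + j)).toL0K.rep x
  have hWm : ∀ j, SetValuedMeasurable μ (W j) := fun j =>
    SetValuedMeasurable.infSum fun k => (U (k + j)).toL0K.measurable_rep
  have hIm : SetValuedMeasurable μ fun x => ConvexSymmSet.iInter fun j => W j x :=
    setValuedMeasurable_of_eq_iInter hWm fun x => rfl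
  have hzero : ∀ᵐ x ∂μ, (L0K.mk _ hIm).val x = {0} := by
    refine L0K.val_eq_zero_of_selections _ fun f hf => ?_
    -- A selection of the intersection is a selection of every tail sum, so its norm is at most
    -- every tail of a convergent series.
    have hmem : ∀ j, ∃ hfX : f ∈ X.carrier, X.norm ⟨f, hfX⟩ ≤ ∑' k, (U (k + j)).norm := by
      intro j
      refine SelectionsBoundedBy.infSum hX (fun k => (U (k + j)).selectionsBoundedBy_norm)
        ((summable_nat_add_iff (f := fun k => (U k).norm) j).2 hU)
        (fun k => (U (k + j)).norm_nonneg) f ?_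
      filter_upwards [hf, L0K.val_mk hIm, L0K.val_infSum fun k => (U (k + j)).toL0K] with x hx h1 h2
      rw [h1] at hx
      rw [h2]
      exact Set.mem_iInter.1 hx j
    obtain ⟨hfX, -⟩ := hmem 0
    have hle : X.norm ⟨f, hfX⟩ ≤ 0 :=
      ge_of_tendsto' (tendsto_sum_nat_add fun k => (U k).norm) fun j => (hmem j).2
    exact congrArg Subtype.val
      (X.eq_zero_of_norm ⟨f, hfX⟩ (le_antisymm hle (apply_nonneg X.norm _)))
  -- The exceptional null set depends on `U` alone, so `A` and `u` may vary with `x`.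
  filter_upwards [hzero, L0K.val_mk hIm] with x hx h1 A hA u hu
  rw [h1] at hx
  refine ConvexSymmSet.mem_of_forall_mem_closure_add (fun j => W j x) ?_ hx hA fun j => ?_
  · refine antitone_nat_of_succ_le fun j => ?_
    have := ConvexSymmSet.tail_subset_infSum fun k => (U (k + j)).toL0K.rep x
    simp_rw [add_right_comm _ 1 j] at this
    exact this
  · refine closure_mono (Set.add_subset_add_left ?_) (hu j)
    have := ConvexSymmSet.head_subset_infSum fun k => (U (k + j)).toL0K.rep x
    rw [zero_add] at this
    exact this

end ConvexSpace

/-! ### The Rubio de Francia iteration -/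

section RubioDeFrancia

variable {T : X.ConvexSpace → X.ConvexSpace} {c : ℝ} (hc : 0 < c)

/-- The tails of the series of scaled iterates. -/
def iterateTail (hX : X.FatouProperty) (hT : ∀ F, c * (T F).norm ≤ 1 / 2 * F.norm)
    (F : X.ConvexSpace) (j : ℕ) : X.ConvexSpace :=
  ConvexSpace.infSum hX (fun k => scaledIterate T c hc F (k + j))
    (summable_norm_scaledIterate hc hT F j)

variable (hX : X.FatouProperty) (hT : ∀ F, c * (T F).norm ≤ 1 / 2 * F.norm) (F : X.ConvexSpace)

theorem norm_iterateTail_le (j : ℕ) :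
    (iterateTail hc hX hT F j).norm ≤ 2 * F.norm * (1 / 2) ^ j := by
  refine (ConvexSpace.norm_infSum_le hX (fun k => scaledIterate T c hc F (k + j))
    (summable_norm_scaledIterate hc hT F j)).trans ?_
  have hs : Summable fun k : ℕ => F.norm * (1 / 2 : ℝ) ^ j * (1 / 2 : ℝ) ^ k :=
    summable_geometric_two.mul_left _
  refine ((summable_norm_scaledIterate hc hT F j).tsum_le_tsum (fun k => ?_) hs).trans_eq ?_
  · refine (norm_scaledIterate_le hc hT F (k + j)).trans_eq ?_
    ring
  · rw [tsum_mul_left, tsum_geometric_two]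
    ring

theorem iterateTail_apply (j : ℕ) : ∀ᵐ x ∂μ, iterateTail hc hX hT F j x =
    closure (scaledIterate T c hc F j x + iterateTail hc hX hT F (j + 1) x) := by
  have h := L0K.val_infSum_succ fun k => (scaledIterate T c hc F (k + j)).toL0K
  simp_rw [add_right_comm _ 1 j, zero_add] at h
  exact h

/-- The images of the tails of the series are controlled by the tails themselves. -/
theorem apply_iterateTail_subset (hsub : IsSublinear T) : ∀ᵐ x ∂μ, ∀ N j,
    T (iterateTail hc hX hT F j) x ⊆ closure (c⁻¹ • iterateTail hc hX hT F (j + 1) x +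
      T (iterateTail hc hX hT F (j + N)) x) := by
  set U := scaledIterate T c hc F with hU
  set W := iterateTail hc hX hT F with hW
  filter_upwards [ae_all_iff.2 fun j => iterateTail_apply hc hX hT F j,
    ae_all_iff.2 fun j => hsub.1 (U j) (W (j + 1)) (W j) (iterateTail_apply hc hX hT F j),
    ae_all_iff.2 fun j => (T (U j)).rsmul_apply c hc] with x hWx hTx hUx
  have hTU : ∀ j, T (U j) x = c⁻¹ • U (j + 1) x := by
    intro j
    have : U (j + 1) x = c • T (U j) x := hUx j
    rw [this, inv_smul_smul₀ hc.ne']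
  -- The index `j` stays universally quantified, since the induction step uses the hypothesis at `j
  -- + 1`.
  intro N
  induction N with
  | zero =>
    intro j u hu
    refine subset_closure ⟨0, ⟨0, (W (j + 1)).toL0K.zero_mem_val x, smul_zero _⟩, u, hu, zero_add u⟩
  | succ N ih =>
    intro j
    refine (hTx j).trans ?_
    rw [hTU]
    refine (closure_mono (Set.add_subset_add_left (ih (j + 1)))).trans ?_
    -- The two multiples of `c⁻¹` combine to `c⁻¹ • (U (j + 1) + W (j + 2))`, which lies in `c⁻¹ • W
    -- (j + 1)`.
    rw [closure_add_closure, ← add_assoc, ← smul_add, show j + 1 + N = j + (N + 1) by ring]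
    refine closure_mono (Set.add_subset_add_right (Set.smul_set_mono ?_))
    have := hWx (j + 1)
    rw [← hW, ← hU] at this
    rw [this]
    exact subset_closure

end RubioDeFrancia

end DirectionalBFS

theorem mainTheorem10 {𝕜 : Type*} [RCLike 𝕜] (d n : ℕ)
    (X : DirectionalBFS 𝕜 n (volume : Measure (EuclideanSpace ℝ (Fin d))))
    (hX : X.FatouProperty)
    (T : X.ConvexSpace → X.ConvexSpace)
    (hT : DirectionalBFS.IsSublinear T)
    (hTb : DirectionalBFS.IsBoundedOp T) :
    ∃ R : X.ConvexSpace → X.ConvexSpace,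
      DirectionalBFS.IsBoundedOp R ∧ DirectionalBFS.opNorm R ≤ 2 ∧
      ∀ F : X.ConvexSpace,
        (∀ᵐ x, F x ⊆ R F x) ∧
        (∀ᵐ x, T (R F) x ⊆ (2 * DirectionalBFS.opNorm T) • R F x) := by
  have hbd := hTb.norm_le_opNorm_mul
  rcases (DirectionalBFS.opNorm_nonneg T).eq_or_lt with h0 | hpos
  · have hid : ∀ F : X.ConvexSpace, (id F).norm ≤ 2 * F.norm := fun F => by
      rw [id]
      linarith [F.norm_nonneg]
    refine ⟨id, ⟨2, by norm_num, hid⟩, DirectionalBFS.opNorm_le (by norm_num) hid, fun F =>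
      ⟨.of_forall fun x => subset_rfl, ?_⟩⟩
    have hF := hbd F
    rw [← h0, zero_mul] at hF
    filter_upwards [(T F).ae_eq_zero_of_norm_nonpos hF] with x hx
    rw [id, hx]
    rintro _ rfl
    exact ⟨0, F.toL0K.zero_mem_val x, smul_zero _⟩
  set C := DirectionalBFS.opNorm T with hC
  -- With this scaling the iterates decay like `2^(-k)`, whose sum is the constant 2 in the bound
  -- for R, and the inverse scaling is the factor `2 * C` in (b).
  have hc : 0 < (2 * C)⁻¹ := by positivity
  have hhalf : ∀ F, (2 * C)⁻¹ * (T F).norm ≤ 1 / 2 * F.norm := by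
    intro F
    rw [inv_mul_le_iff₀ (by positivity)]
    linarith [hbd F]
  set W := DirectionalBFS.iterateTail hc hX hhalf with hW
  have hWn : ∀ F, (W F 0).norm ≤ 2 * F.norm := fun F => by
    have := DirectionalBFS.norm_iterateTail_le hc hX hhalf F 0
    rwa [pow_zero, mul_one] at this
  refine ⟨fun F => W F 0, ⟨2, by norm_num, hWn⟩, DirectionalBFS.opNorm_le (by norm_num) hWn,
    fun F => ⟨?_, ?_⟩⟩
  · filter_upwards [DirectionalBFS.iterateTail_apply hc hX hhalf F 0] with x hx u hu
    refine hx ▸ subset_closure ⟨u, hu, 0, ?_, add_zero u⟩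
    exact (W F 1).toL0K.zero_mem_val x
  · have hs : Summable fun j => (T (W F j)).norm := by
      refine Summable.of_nonneg_of_le (fun j => (T (W F j)).norm_nonneg)
        (fun j => (hbd (W F j)).trans (mul_le_mul_of_nonneg_left
          (DirectionalBFS.norm_iterateTail_le hc hX hhalf F j) hpos.le)) ?_
      exact (summable_geometric_two.mul_left _).mul_left _
    filter_upwards [DirectionalBFS.ConvexSpace.ae_mem_of_forall_mem_closure_add hX _ hs,
      DirectionalBFS.apply_iterateTail_subset hc hX hhalf F hT,
      DirectionalBFS.iterateTail_apply hc hX hhalf F 0] with x hx hsub h0 u hu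
    -- The closed set is `(2 * C) • W F 0 x` and the perturbations are the remainders `T (W F j) x`;
    -- passing from `W F 1` to the larger `W F 0` gives the required form.
    refine hx _ ((W F 0).toL0K.isClosed_val x |>.smul_of_ne_zero (by positivity)) u fun j => ?_
    have h1 := hsub j 0 hu
    rw [inv_inv, zero_add, zero_add] at h1
    refine closure_mono (Set.add_subset_add_right (Set.smul_set_mono ?_)) h1
    intro v hv
    refine h0 ▸ subset_closure ⟨0, ?_, v, hv, zero_add v⟩
    exact L0K.zero_mem_val _ x

end
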